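/- Let $R>0$ and $0<\nu<\lambda<\mu<1$ satisfy the balance condition $\left(\frac{1+\mu}{1-\mu}\right)^3=\left(\frac{1+\lambda}{1-\lambda}\right)^2\left(\frac{1+\nu}{1-\nu}\right)^2$, and put $F(\xi)=1-\mu\xi$, $G(\xi)=(1-\xi^2)(1-\lambda\xi)(1-\nu\xi)$, $C=\sqrt{\lambda\nu}$. Consider the region $\frac1\mu<y<\frac1\lambda$, between the curvature singularity $y=\frac1\mu$ and the inner horizon $y=\frac1\lambda$, of the non-extremal dipole black ring, with the metric $$ds^2=-\frac{F(x)}{F(y)}\left(dt+RC(1+y)d\psi\right)^2+\frac{R^2}{(x-y)^2}\left[-F(x)\left(\frac{G(y)}{F(y)}d\psi^2+\frac{F(y)^2}{G(y)}dy^2\right)+F(y)^2\left(\frac{F(x)}{G(x)}dx^2+\frac{G(x)}{F(x)^2}d\phi^2\right)\right],$$ where $t\in\mathbb R$, $\psi$ is an angle, and $(x,\phi)$, $-1\le x\le 1$, are coordinates on a two-sphere on which the metric is smoothly extended to the poles (axes) $x=\pm1$, the period of $\phi$ being $4\pi F(1)^{3/2}/|G'(1)|$. For an affinely parametrized geodesic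 $\gamma$ of this region defined on an open interval, let $p_t=g(\partial_t,\dot\gamma)$, $p_\psi=g(\partial_\psi,\dot\gamma)$, $p_\phi=g(\partial_\phi,\dot\gamma)$, and say that $\gamma$ reaches the singularity if $y(\gamma(s))\to\frac1\mu$ as $s$ tends to the (finite or infinite) upper end of the interval. Then: 1. Every causal geodesic that reaches the singularity is null and has $p_\phi=0$. 2. No timelike geodesic reaches the singularity. 3. Through every point of the region and for every $P\neq0$ there is a null geodesic with $p_t=0$ (zero energy), $p_\phi=0$ and $p_\psi=P$ that reaches the singularity in finite affine time. -/

import Mathlib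

open Filter Topology

noncomputable section

namespace DipoleRing

/-- The parameters of the dipole black ring. -/
structure Params where
  R : ℝ
  nu : ℝ
  lam : ℝ
  mu : ℝ

namespace Params

variable (p : Params)

/-- `F(ξ) = 1 - μ ξ`. -/
def F (ξ : ℝ) : ℝ := 1 - p.mu * ξ

/-- The factor `(1 - λ ξ)(1 - ν ξ)` of `G`. -/
def Gred (ξ : ℝ) : ℝ := (1 - p.lam * ξ) * (1 - p.nu * ξ)

/-- `G(ξ) = (1 - ξ²)(1 - λ ξ)(1 - ν ξ)`. -/
def G (ξ : ℝ) : ℝ := (1 - ξ ^ 2) * p.Gred ξ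

/-- `C = √(λ ν)`. -/
def C : ℝ := √(p.lam * p.nu)

/-- `0 < ν < λ < μ < 1` and `R > 0`, with the balance condition that removes the conical
singularities on both axes `x = 1` and `x = -1`: the non-extremal dipole black ring. -/
structure NonExtremal : Prop where
  R_pos : 0 < p.R
  nu_pos : 0 < p.nu
  nu_lt_lam : p.nu < p.lam
  lam_lt_mu : p.lam < p.mu
  mu_lt_one : p.mu < 1
  balance : ((1 + p.mu) / (1 - p.mu)) ^ 3 =
    ((1 + p.lam) / (1 - p.lam)) ^ 2 * ((1 + p.nu) / (1 - p.nu)) ^ 2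

/-- The dipole ring metric `g(u, v)` in the coordinates `(t, y, ψ, x, φ)`, which are
numbered `0, 1, 2, 3, 4`; it is singular on the axes `x = 1` and `x = -1`. -/
def polarMetric (q u v : Fin 5 → ℝ) : ℝ :=
  let y := q 1;
  let x := q 3;
  -(p.F x / p.F y) * ((u 0 + p.R * p.C * (1 + y) * u 2) * (v 0 + p.R * p.C * (1 + y) * v 2))
  + p.R ^ 2 / (x - y) ^ 2 *
    (-(p.F x) * (p.G y / p.F y * (u 2 * v 2) + p.F y ^ 2 / p.G y * (u 1 * v 1))
      + p.F y ^ 2 * (p.F x / p.G x * (u 3 * v 3) + p.G x / p.F x ^ 2 * (u 4 * v 4)))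

/-- The ratio `2π / Δφ`, where `Δφ` is the period of `φ`: the angle on the sphere is `κ φ`. -/
def kappa : ℝ := p.Gred 1 / (p.F 1 * √(p.F 1))

/-- The polynomial `(κ² F³ - Gred²)(x) / (1 - x²)`. -/
def axisPoly (x : ℝ) : ℝ :=
  (p.kappa ^ 2 - 1) + (p.kappa ^ 2 * p.mu ^ 3 - 2 * p.lam * p.nu * (p.lam + p.nu)) * x
    + p.lam ^ 2 * p.nu ^ 2 * x ^ 2

/-- The regular form of `F(x)/G(x) dx² + G(x)/F(x)² dφ²` on the unit sphere
`n = (√(1 - x²) cos κφ, √(1 - x²) sin κφ, x)`, including the poles `x = ±1`. -/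
def sphereMetric (n u v : Fin 3 → ℝ) : ℝ :=
  p.Gred (n 2) / (p.kappa ^ 2 * p.F (n 2) ^ 2) * (u 0 * v 0 + u 1 * v 1 + u 2 * v 2)
  + p.axisPoly (n 2) / (p.kappa ^ 2 * p.Gred (n 2) * p.F (n 2) ^ 2) * (u 2 * v 2)

/-- The dipole ring metric at the point `q = (t, y, ψ, n₁, n₂, n₃)`, where `(n₁, n₂, n₃)` is on the
unit sphere of the variables `(x, φ)` and `x = n₃`. It agrees with `polarMetric` off the axes
(`metric_eq_polarMetric`) and is regular on them. The angle `ψ` is lifted to the real line. -/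
def metric (q u v : Fin 6 → ℝ) : ℝ :=
  let y := q 1;
  let x := q 5;
  -(p.F x / p.F y) * ((u 0 + p.R * p.C * (1 + y) * u 2) * (v 0 + p.R * p.C * (1 + y) * v 2))
  + p.R ^ 2 / (x - y) ^ 2 *
    (-(p.F x) * (p.G y / p.F y * (u 2 * v 2) + p.F y ^ 2 / p.G y * (u 1 * v 1))
      + p.F y ^ 2 * p.sphereMetric ![q 3, q 4, q 5] ![u 3, u 4, u 5] ![v 3, v 4, v 5])

/-- The region between the curvature singularity `y = 1/μ` and the inner horizon `y = 1/λ`,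
with the axes `x = ±1` included. -/
def region : Set (Fin 6 → ℝ) :=
  {q | 1 / p.mu < q 1 ∧ q 1 < 1 / p.lam ∧ q 3 ^ 2 + q 4 ^ 2 + q 5 ^ 2 = 1}

/-- The Killing field `∂_t`. -/
def dt : Fin 6 → ℝ := Pi.single 0 1

/-- The Killing field `∂_ψ`. -/
def dpsi : Fin 6 → ℝ := Pi.single 2 1

/-- The Killing field `∂_φ`, the rotation of the sphere about its third axis with speed `κ`. -/
def dphi (q : Fin 6 → ℝ) : Fin 6 → ℝ := ![0, 0, 0, -(p.kappa * q 4), p.kappa * q 3, 0]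

/-- `γ` is an affinely parametrized geodesic of the region on `I`. The Lagrangian is
`L(q, v) = g_q(v, v) / 2`, so `∂L/∂vᵏ = g_q(e_k, v)`; since the coordinates `(n₁, n₂, n₃)` are
bound to the unit sphere, the Euler–Lagrange equations hold up to a multiple `m(s)` of the
normal `(0, 0, 0, n₁, n₂, n₃)`, i.e. they hold in all directions tangent to the space-time. -/
def IsGeodesicOn (γ : ℝ → Fin 6 → ℝ) (I : Set ℝ) : Prop :=
  (∀ s ∈ I, γ s ∈ p.region) ∧
  (∀ s ∈ I, DifferentiableAt ℝ γ s ∧ DifferentiableAt ℝ (deriv γ) s) ∧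
  ∃ m : ℝ → ℝ, ∀ s ∈ I, ∀ k : Fin 6,
    HasDerivAt (fun r => p.metric (γ r) (Pi.single k 1) (deriv γ r))
      (lineDeriv ℝ (fun q => p.metric q (deriv γ s) (deriv γ s) / 2) (γ s) (Pi.single k 1)
        + m s * (if 3 ≤ k then γ s k else 0)) s

/-- The squared length `g(γ̇, γ̇)` of the velocity. -/
def speedSq (γ : ℝ → Fin 6 → ℝ) (s : ℝ) : ℝ := p.metric (γ s) (deriv γ s) (deriv γ s)

/-- `p_t = g(∂_t, γ̇)`, the negative of the energy. -/
def pt (γ : ℝ → Fin 6 → ℝ) (s : ℝ) : ℝ := p.metric (γ s) dt (deriv γ s)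

/-- `p_ψ = g(∂_ψ, γ̇)`. -/
def ppsi (γ : ℝ → Fin 6 → ℝ) (s : ℝ) : ℝ := p.metric (γ s) dpsi (deriv γ s)

/-- `p_φ = g(∂_φ, γ̇)`. -/
def pphi (γ : ℝ → Fin 6 → ℝ) (s : ℝ) : ℝ := p.metric (γ s) (p.dphi (γ s)) (deriv γ s)

def IsCausalOn (γ : ℝ → Fin 6 → ℝ) (I : Set ℝ) : Prop :=
  ∀ s ∈ I, deriv γ s ≠ 0 ∧ p.speedSq γ s ≤ 0

def IsTimelikeOn (γ : ℝ → Fin 6 → ℝ) (I : Set ℝ) : Prop :=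
  ∀ s ∈ I, p.speedSq γ s < 0

def IsNullOn (γ : ℝ → Fin 6 → ℝ) (I : Set ℝ) : Prop :=
  ∀ s ∈ I, deriv γ s ≠ 0 ∧ p.speedSq γ s = 0

/-- `y(s) → 1/μ` as `s` tends in `I` to the upper end (finite or not) of the open interval `I`. -/
def ReachesSingularity (γ : ℝ → Fin 6 → ℝ) (I : Set ℝ) : Prop :=
  Tendsto (fun s : I => γ s 1) atTop (𝓝 (1 / p.mu))

variable {p}

lemma NonExtremal.axisPoly_eq (h : p.NonExtremal) (x : ℝ) :
    (1 - x ^ 2) * p.axisPoly x = p.kappa ^ 2 * p.F x ^ 3 - p.Gred x ^ 2 := by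
  obtain ⟨-, h1, h2, h3, h4, hb⟩ := h
  have a1 : 0 < 1 - p.mu := by linarith
  have a2 : 0 < 1 - p.lam := by linarith
  have a3 : 0 < 1 - p.nu := by linarith
  have hk : p.kappa ^ 2 * (1 - p.mu) ^ 3 = ((1 - p.lam) * (1 - p.nu)) ^ 2 := by
    simp only [kappa, F, Gred, mul_one]
    rw [div_pow, mul_pow _ (√_), Real.sq_sqrt a1.le]
    field_simp
  have hk2 : p.kappa ^ 2 * (1 + p.mu) ^ 3 = ((1 + p.lam) * (1 + p.nu)) ^ 2 := by
    have : p.kappa ^ 2 = ((1 - p.lam) * (1 - p.nu)) ^ 2 / (1 - p.mu) ^ 3 := by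
      rw [eq_div_iff (by positivity), hk]
    rw [this]
    field_simp at hb ⊢
    linear_combination hb
  simp only [axisPoly, F, Gred]
  linear_combination (-(x ^ 2 + x) / 2) * hk - ((x ^ 2 - x) / 2) * hk2

/-- Off the axes the metric is the one in the coordinates `(t, y, ψ, x, φ)`: a tangent vector
`u` has `dx(u) = u₅` and `dφ(u) = (n₁ u₄ - n₂ u₃) / (κ (1 - x²))`. -/
lemma metric_eq_polarMetric (h : p.NonExtremal) (φ : ℝ) (q u v : Fin 6 → ℝ) (hq : q ∈ p.region)
    (hx : q 5 ^ 2 < 1) (hu : q 3 * u 3 + q 4 * u 4 + q 5 * u 5 = 0)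
    (hv : q 3 * v 3 + q 4 * v 4 + q 5 * v 5 = 0) :
    p.metric q u v = p.polarMetric ![q 0, q 1, q 2, q 5, φ]
      ![u 0, u 1, u 2, u 5, (q 3 * u 4 - q 4 * u 3) / (p.kappa * (1 - q 5 ^ 2))]
      ![v 0, v 1, v 2, v 5, (q 3 * v 4 - q 4 * v 3) / (p.kappa * (1 - q 5 ^ 2))] := by
  obtain ⟨-, -, hn⟩ := hq
  have hP := h.axisPoly_eq (q 5)
  obtain ⟨-, h1, h2, h3, h4, -⟩ := h
  have b1 : -1 < q 5 := by nlinarith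
  have b2 : q 5 < 1 := by nlinarith
  have aux : ∀ c : ℝ, 0 < c → c < 1 → 0 < 1 - c * q 5 := fun c h0 h1 => by nlinarith
  have hF : p.F (q 5) ≠ 0 := (aux p.mu (by linarith) h4).ne'
  have hG : p.Gred (q 5) ≠ 0 :=
    (mul_pos (aux p.lam (by linarith) (by linarith)) (aux p.nu h1 (by linarith))).ne'
  have hk : p.kappa ≠ 0 := by
    have a1 : 0 < 1 - p.mu := by linarith
    have a2 : 0 < 1 - p.lam := by linarith
    have a3 : 0 < 1 - p.nu := by linarith
    have a4 := Real.sqrt_pos.2 a1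
    simp only [kappa, F, Gred, mul_one]
    positivity
  have hd : 1 - q 5 ^ 2 ≠ 0 := by nlinarith
  have key : (1 - q 5 ^ 2) * (u 3 * v 3 + u 4 * v 4 + u 5 * v 5) =
      (q 3 * u 4 - q 4 * u 3) * (q 3 * v 4 - q 4 * v 3) + u 5 * v 5 := by
    linear_combination (-(u 3 * v 3 + u 4 * v 4)) * hn + (q 3 * v 3 + q 4 * v 4) * hu
      - (q 5 * u 5) * hv
  have sph : p.sphereMetric ![q 3, q 4, q 5] ![u 3, u 4, u 5] ![v 3, v 4, v 5] =
      p.F (q 5) / p.G (q 5) * (u 5 * v 5) + p.G (q 5) / p.F (q 5) ^ 2 *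
        ((q 3 * u 4 - q 4 * u 3) / (p.kappa * (1 - q 5 ^ 2)) *
          ((q 3 * v 4 - q 4 * v 3) / (p.kappa * (1 - q 5 ^ 2)))) := by
    simp [sphereMetric, G]
    field_simp
    linear_combination p.Gred (q 5) ^ 2 * key + (u 5 * v 5) * hP
  simp only [metric, polarMetric, sph]
  simp

end Params

end DipoleRing

end

open Filter Topology

namespace DipoleRing.Params

variable {p : Params}

/-! In the region `F(y) < 0` and `G(y) < 0`, so the only negative term of `g(v, v)` is the `dψ²`
term inside the bracket. The combination `p_ψ - RC(1+y) p_t` is a multiple of `ψ'` alone, so this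
term equals `(x-y)² F(y) / (R² F(x) G(y)) · (p_ψ - RC(1+y) p_t)²`. The momenta and `g(γ̇, γ̇)` are
conserved, while `F(y) → 0` at the singularity with `G` nonzero there, so the negative term tends to
zero. For a causal geodesic this forces `g(γ̇, γ̇) = 0` and makes the sphere part of `g(γ̇, γ̇)`
tend to zero. Since `p_φ²` is at most that part times a factor of order `F(y)²`, also `p_φ = 0`. The
carriers are `exists_metric_ge`, `IsGeodesicOn.hasDerivAt_speedSq` and
`ReachesSingularity.causal_momenta`.

For existence, take `p_t = 0` and keep the point of the sphere fixed. The first square of the metric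
then vanishes, and nullity makes the `(ψ, y)` bracket vanish too. As `x` enters only through factors
of these two expressions, no force acts along the sphere. What remains is `y' = -K (x-y)² /
√(-F(y))`, which becomes separable with a finite time of arrival in the variable `w = √(-F(y))`; `t`
and `ψ` follow by integration. -/

lemma NonExtremal.F_pos (h : p.NonExtremal) {x : ℝ} (hx : x ≤ 1) : 0 < p.F x := by
  obtain ⟨-, h1, h2, h3, h4, -⟩ := h
  simp only [F]
  nlinarith

lemma NonExtremal.Gred_pos (h : p.NonExtremal) {x : ℝ} (hx : x ≤ 1) : 0 < p.Gred x := by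
  obtain ⟨-, h1, h2, h3, h4, -⟩ := h
  simp only [Gred]
  exact mul_pos (by nlinarith) (by nlinarith)

lemma NonExtremal.kappa_pos (h : p.NonExtremal) : 0 < p.kappa :=
  div_pos (h.Gred_pos le_rfl) (mul_pos (h.F_pos le_rfl) (Real.sqrt_pos.2 (h.F_pos le_rfl)))

lemma NonExtremal.one_lt_inv_mu (h : p.NonExtremal) : 1 < 1 / p.mu := by
  obtain ⟨-, h1, h2, h3, h4, -⟩ := h
  rw [lt_div_iff₀] <;> linarith

lemma NonExtremal.F_neg (h : p.NonExtremal) {y : ℝ} (hy : 1 / p.mu < y) : p.F y < 0 := by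
  obtain ⟨-, h1, h2, h3, h4, -⟩ := h
  rw [div_lt_iff₀ (by linarith)] at hy
  simp only [F]
  linarith

/-- The range starts at `1` rather than `1/μ` so that it contains the singularity itself, where the
limits need `G ≠ 0`. -/
lemma NonExtremal.G_neg (h : p.NonExtremal) {y : ℝ} (hy : 1 < y) (hy' : y < 1 / p.lam) :
    p.G y < 0 := by
  obtain ⟨-, h1, h2, h3, h4, -⟩ := h
  rw [lt_div_iff₀ (by linarith)] at hy'
  simp only [G, Gred]
  exact mul_neg_of_neg_of_pos (by nlinarith) (mul_pos (by linarith) (by nlinarith))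

lemma x_le_one {q : Fin 6 → ℝ} (hq : q ∈ p.region) : q 5 ≤ 1 := by
  obtain ⟨-, -, hn⟩ := hq
  nlinarith [sq_nonneg (q 3), sq_nonneg (q 4)]

lemma neg_one_le_x {q : Fin 6 → ℝ} (hq : q ∈ p.region) : -1 ≤ q 5 := by
  obtain ⟨-, -, hn⟩ := hq
  nlinarith [sq_nonneg (q 3), sq_nonneg (q 4)]

lemma NonExtremal.one_lt_y (h : p.NonExtremal) {q : Fin 6 → ℝ} (hq : q ∈ p.region) : 1 < q 1 :=
  h.one_lt_inv_mu.trans hq.1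

/-! ### Dependence of the metric on the point and on the vectors -/

lemma metric_apply (q u v : Fin 6 → ℝ) : p.metric q u v =
    -(p.F (q 5) / p.F (q 1)) *
      ((u 0 + p.R * p.C * (1 + q 1) * u 2) * (v 0 + p.R * p.C * (1 + q 1) * v 2))
    + p.R ^ 2 / (q 5 - q 1) ^ 2 *
      (-(p.F (q 5)) *
          (p.G (q 1) / p.F (q 1) * (u 2 * v 2) + p.F (q 1) ^ 2 / p.G (q 1) * (u 1 * v 1))
        + p.F (q 1) ^ 2 *
          (p.Gred (q 5) / (p.kappa ^ 2 * p.F (q 5) ^ 2) * (u 3 * v 3 + u 4 * v 4 + u 5 * v 5)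
          + p.axisPoly (q 5) / (p.kappa ^ 2 * p.Gred (q 5) * p.F (q 5) ^ 2) * (u 5 * v 5))) := by
  simp [metric, sphereMetric]

lemma metric_congr {q q' : Fin 6 → ℝ} (h1 : q 1 = q' 1) (h5 : q 5 = q' 5) (u v : Fin 6 → ℝ) :
    p.metric q u v = p.metric q' u v := by
  simp only [metric_apply, h1, h5]

lemma metric_eq_sum_left (q u v : Fin 6 → ℝ) :
    p.metric q u v = ∑ k, u k * p.metric q (Pi.single k 1) v := by
  simp [Fin.sum_univ_six, metric_apply, Pi.single_apply]
  ring

lemma metric_sub_right (q u v w : Fin 6 → ℝ) :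
    p.metric q u (v - w) = p.metric q u v - p.metric q u w := by
  simp only [metric_apply, Pi.sub_apply]; ring

lemma differentiable_F : Differentiable ℝ p.F := by unfold F; fun_prop

lemma differentiable_Gred : Differentiable ℝ p.Gred := by unfold Gred; fun_prop

lemma differentiable_G : Differentiable ℝ p.G := by unfold G Gred; fun_prop

lemma differentiable_axisPoly : Differentiable ℝ p.axisPoly := by unfold axisPoly; fun_prop

lemma NonExtremal.differentiableAt_metric (h : p.NonExtremal) {q : Fin 6 → ℝ} (hq : q ∈ p.region)
    (u v : Fin 6 → ℝ) : DifferentiableAt ℝ (fun q => p.metric q u v) q := by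
  have hx := x_le_one hq
  have hy := h.one_lt_y hq
  have e1 := (h.F_neg hq.1).ne
  have e2 := (h.G_neg hy hq.2.1).ne
  have e3 := (h.F_pos hx).ne'
  have e4 := (h.Gred_pos hx).ne'
  have e5 := h.kappa_pos.ne'
  have e6 : q 5 - q 1 ≠ 0 := by linarith
  have d1 := (differentiable_F (p := p)).differentiableAt (x := q 1)
  have d2 := (differentiable_F (p := p)).differentiableAt (x := q 5)
  have d3 := (differentiable_G (p := p)).differentiableAt (x := q 1)
  have d4 := (differentiable_Gred (p := p)).differentiableAt (x := q 5)
  have d5 := (differentiable_axisPoly (p := p)).differentiableAt (x := q 5)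
  simp only [metric_apply]
  have c1 : DifferentiableAt ℝ (fun q : Fin 6 → ℝ => q 1) q := by fun_prop
  have c5 : DifferentiableAt ℝ (fun q : Fin 6 → ℝ => q 5) q := by fun_prop
  have D1 : DifferentiableAt ℝ (fun q : Fin 6 → ℝ => p.F (q 1)) q :=
    DifferentiableAt.comp (g := p.F) q d1 c1
  have D2 : DifferentiableAt ℝ (fun q : Fin 6 → ℝ => p.F (q 5)) q :=
    DifferentiableAt.comp (g := p.F) q d2 c5
  have D3 : DifferentiableAt ℝ (fun q : Fin 6 → ℝ => p.G (q 1)) q :=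
    DifferentiableAt.comp (g := p.G) q d3 c1
  have D4 : DifferentiableAt ℝ (fun q : Fin 6 → ℝ => p.Gred (q 5)) q :=
    DifferentiableAt.comp (g := p.Gred) q d4 c5
  have D5 : DifferentiableAt ℝ (fun q : Fin 6 → ℝ => p.axisPoly (q 5)) q :=
    DifferentiableAt.comp (g := p.axisPoly) q d5 c5
  have n6 : (q 5 - q 1) ^ 2 ≠ 0 := pow_ne_zero _ e6
  have n7 : p.kappa ^ 2 * p.F (q 5) ^ 2 ≠ 0 := by positivity
  have n8 : p.kappa ^ 2 * p.Gred (q 5) * p.F (q 5) ^ 2 ≠ 0 := by positivity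
  fun_prop (disch := assumption)

/-- The coefficients involve only `y` and `x = n₃`, so every other coordinate is cyclic in the
Lagrangian, even off the sphere. -/
lemma lineDeriv_metric_eq_zero (q u v : Fin 6 → ℝ) {k : Fin 6} (h1 : k ≠ 1) (h5 : k ≠ 5) :
    lineDeriv ℝ (fun q => p.metric q u v / 2) q (Pi.single k 1) = 0 := by
  have : (fun t : ℝ => p.metric (q + t • Pi.single k 1) u v / 2) =
      fun _ => p.metric q u v / 2 := by
    funext t
    rw [metric_congr (q' := q)] <;> simp [h1.symm, h5.symm]
  rw [lineDeriv, this, deriv_const]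

lemma const_of_hasDerivAt_zero {I : Set ℝ} (hI : IsOpen I) (hc : I.OrdConnected) {f : ℝ → ℝ}
    (hf : ∀ s ∈ I, HasDerivAt f 0 s) {s r : ℝ} (hs : s ∈ I) (hr : r ∈ I) : f s = f r :=
  hI.is_const_of_deriv_eq_zero hc.isPreconnected
    (fun x hx => (hf x hx).differentiableAt.differentiableWithinAt)
    (fun x hx => (hf x hx).deriv) hs hr

lemma clm_apply_eq_sum (L : (Fin 6 → ℝ) →L[ℝ] ℝ) (u : Fin 6 → ℝ) :
    L u = ∑ k, u k * L (Pi.single k 1) := by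
  conv_lhs => rw [pi_eq_sum_univ' u, map_sum]
  refine Finset.sum_congr rfl fun k _ => ?_
  rw [map_smul, smul_eq_mul]

/-! ### Conserved quantities of geodesics -/

section Conservation

variable {I : Set ℝ} {γ : ℝ → Fin 6 → ℝ}

lemma IsGeodesicOn.hasDerivAt_coord (hg : p.IsGeodesicOn γ I) {s : ℝ} (hs : s ∈ I) (k : Fin 6) :
    HasDerivAt (fun r => γ r k) (deriv γ s k) s :=
  hasDerivAt_pi.1 (hg.2.1 s hs).1.hasDerivAt k

lemma IsGeodesicOn.sphere_tangent (hg : p.IsGeodesicOn γ I) (hI : IsOpen I) {s : ℝ} (hs : s ∈ I) :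
    γ s 3 * deriv γ s 3 + γ s 4 * deriv γ s 4 + γ s 5 * deriv γ s 5 = 0 := by
  have h1 := (((hg.hasDerivAt_coord hs 3).pow 2).add ((hg.hasDerivAt_coord hs 4).pow 2)).add
    ((hg.hasDerivAt_coord hs 5).pow 2)
  have h2 : HasDerivAt (fun r => γ r 3 ^ 2 + γ r 4 ^ 2 + γ r 5 ^ 2) 0 s := by
    refine (hasDerivAt_const s (1 : ℝ)).congr_of_eventuallyEq ?_
    filter_upwards [hI.mem_nhds hs] with r hr using (hg.1 r hr).2.2
  have := h1.unique h2
  norm_num at this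
  linarith

lemma IsGeodesicOn.hasDerivAt_pt (hg : p.IsGeodesicOn γ I) {s : ℝ} (hs : s ∈ I) :
    HasDerivAt (p.pt γ) 0 s := by
  obtain ⟨-, -, m, hm⟩ := hg
  have := hm s hs 0
  rw [lineDeriv_metric_eq_zero _ _ _ (by decide) (by decide)] at this
  rw [if_neg (by decide), mul_zero, add_zero] at this
  exact this

lemma IsGeodesicOn.hasDerivAt_ppsi (hg : p.IsGeodesicOn γ I) {s : ℝ} (hs : s ∈ I) :
    HasDerivAt (p.ppsi γ) 0 s := by
  obtain ⟨-, -, m, hm⟩ := hg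
  have := hm s hs 2
  rw [lineDeriv_metric_eq_zero _ _ _ (by decide) (by decide)] at this
  rw [if_neg (by decide), mul_zero, add_zero] at this
  exact this

/-- Up to the factor `κ`, `p_φ` is `n₁ ∂L/∂v⁴ - n₂ ∂L/∂v³`. The constraint forces cancel because
they are radial, and the terms with `n₁'`, `n₂'` cancel because the metric is isotropic in these two
directions. -/
lemma IsGeodesicOn.hasDerivAt_pphi (hg : p.IsGeodesicOn γ I) {s : ℝ} (hs : s ∈ I) :
    HasDerivAt (p.pphi γ) 0 s := by
  have c3 := hg.hasDerivAt_coord hs 3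
  have c4 := hg.hasDerivAt_coord hs 4
  obtain ⟨-, -, m, hm⟩ := hg
  have h3 := hm s hs 3
  have h4 := hm s hs 4
  rw [lineDeriv_metric_eq_zero _ _ _ (by decide) (by decide), if_pos (by decide)] at h3 h4
  have := ((c3.mul h4).sub (c4.mul h3)).const_mul p.kappa
  refine (this.congr_of_eventuallyEq (Eventually.of_forall fun r => ?_)).congr_deriv ?_
  · simp [pphi, metric_apply, dphi]
    ring
  · simp only [metric_apply]
    simp
    exact Or.inr (by ring)

/-- With `u` the velocity frozen at `s`, bilinearity and symmetry give `g(v, v) = 2 g(u, v) - g(u,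
u) + g(v-u, v-u)` along the curve. The Euler–Lagrange equations differentiate the first term and the
chain rule the second; these contributions cancel, and the last term is of second order. -/
lemma IsGeodesicOn.hasDerivAt_speedSq (h : p.NonExtremal) (hg : p.IsGeodesicOn γ I)
    (hI : IsOpen I) {s : ℝ} (hs : s ∈ I) : HasDerivAt (p.speedSq γ) 0 s := by
  have htan := hg.sphere_tangent hI hs
  obtain ⟨hreg, hd, m, hm⟩ := hg
  obtain ⟨hd1, hd2⟩ := hd s hs
  have hmet : ∀ u v, DifferentiableAt ℝ (fun q => p.metric q u v) (γ s) :=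
    h.differentiableAt_metric (hreg s hs)
  set u := deriv γ s with hu
  have hacc : ∀ k, HasDerivAt (fun r => deriv γ r k) (deriv (deriv γ) s k) s :=
    hasDerivAt_pi.1 hd2.hasDerivAt
  set T := ∑ k, u k * lineDeriv ℝ (fun q => p.metric q u u / 2) (γ s) (Pi.single k 1) with hT
  have hfix : HasDerivAt (fun r => p.metric (γ r) u u) (2 * T) s := by
    have hL : DifferentiableAt ℝ (fun q => p.metric q u u / 2) (γ s) := by
      have := hmet u u
      fun_prop
    have h1 := (hL.hasFDerivAt.comp_hasDerivAt s hd1.hasDerivAt).const_mul 2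
    refine (h1.congr_of_eventuallyEq (Eventually.of_forall fun r => ?_)).congr_deriv ?_
    · simp; ring
    · rw [hT]
      congr 1
      simp only [hL.lineDeriv_eq_fderiv]
      exact clm_apply_eq_sum _ _
  have hmixed : HasDerivAt (fun r => p.metric (γ r) u (deriv γ r)) T s := by
    have h1 := HasDerivAt.fun_sum (u := Finset.univ) fun k _ => (hm s hs k).const_mul (u k)
    refine (h1.congr_of_eventuallyEq (Eventually.of_forall fun r => ?_)).congr_deriv ?_
    · exact metric_eq_sum_left _ _ _
    · simp only [mul_add, Finset.sum_add_distrib]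
      -- The multiplier contributes `m` times the product of `u` with the normal, which is zero by
      -- tangency to the sphere.
      rw [hT, add_eq_left]
      rw [Fin.sum_univ_six, if_neg (by decide), if_neg (by decide), if_neg (by decide),
        if_pos (by decide), if_pos (by decide), if_pos (by decide)]
      linear_combination m s * htan
  -- Expanded over the basis, each summand is a product of two factors that both vanish at `s`.
  have hsmall : HasDerivAt (fun r => p.metric (γ r) (deriv γ r - u) (deriv γ r - u)) 0 s := by
    have h1 := HasDerivAt.fun_sum (u := Finset.univ) fun k _ =>
      ((hacc k).sub_const (u k)).mul ((hm s hs k).sub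
        ((hmet (Pi.single k 1) u).hasFDerivAt.comp_hasDerivAt s hd1.hasDerivAt))
    refine (h1.congr_of_eventuallyEq (Eventually.of_forall fun r => ?_)).congr_deriv ?_
    · simp only []
      rw [metric_eq_sum_left]
      simp [metric_sub_right]
    · simp [hu]
  have := ((hmixed.const_mul 2).sub hfix).add hsmall
  refine (this.congr_of_eventuallyEq (Eventually.of_forall fun r => ?_)).congr_deriv (by ring)
  simp only [speedSq, Pi.add_apply, Pi.sub_apply, metric_apply]
  ring

end Conservation

end DipoleRing.Params

namespace DipoleRing.Params

variable {p : Params}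

/-! ### Bounds near the singularity -/

variable (p) in
/-- The negative part of `g(v, v)` for `p_t = a` and `p_ψ = b` is at least `-singBound y a b`. -/
noncomputable def singBound (y a b : ℝ) : ℝ :=
  (1 + y) ^ 2 / (p.R ^ 2 * (1 - p.mu)) * (p.F y / p.G y) * (b - p.R * p.C * (1 + y) * a) ^ 2

lemma NonExtremal.tendsto_singBound (h : p.NonExtremal) (a b : ℝ) :
    Tendsto (fun y => p.singBound y a b) (𝓝 (1 / p.mu)) (𝓝 0) := by
  have hmu : 0 < p.mu := by linarith [h.nu_pos, h.nu_lt_lam, h.lam_lt_mu]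
  have hlam : 0 < p.lam := h.nu_pos.trans h.nu_lt_lam
  have hG : p.G (1 / p.mu) ≠ 0 :=
    (h.G_neg h.one_lt_inv_mu (one_div_lt_one_div_of_lt hlam h.lam_lt_mu)).ne
  have cF : ContinuousAt p.F (1 / p.mu) := differentiable_F.continuous.continuousAt
  have cG : ContinuousAt p.G (1 / p.mu) := differentiable_G.continuous.continuousAt
  have hc : ContinuousAt (fun y => p.singBound y a b) (1 / p.mu) := by
    unfold singBound
    exact (ContinuousAt.mul (by fun_prop) (cF.div cG hG)).mul (by fun_prop)
  have h0 : p.singBound (1 / p.mu) a b = 0 := by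
    have : p.F (1 / p.mu) = 0 := by simp [F, hmu.ne']
    rw [singBound, this]
    simp
  simpa only [ContinuousAt, h0] using hc

variable (p) in
/-- A bound for `p_φ²` relative to the part of `g(v, v)` along the sphere. -/
noncomputable def axialBound (y : ℝ) : ℝ :=
  4 * p.R ^ 2 * p.F y ^ 2 / ((y - 1) ^ 2 * (1 - p.mu) ^ 2)

lemma axialBound_nonneg (y : ℝ) : 0 ≤ p.axialBound y := by
  unfold axialBound; positivity

lemma NonExtremal.tendsto_axialBound (h : p.NonExtremal) :
    Tendsto p.axialBound (𝓝 (1 / p.mu)) (𝓝 0) := by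
  have hmu : 0 < p.mu := by linarith [h.nu_pos, h.nu_lt_lam, h.lam_lt_mu]
  have cF : ContinuousAt p.F (1 / p.mu) := differentiable_F.continuous.continuousAt
  have e1 : 1 / p.mu - 1 ≠ 0 := by linarith [h.one_lt_inv_mu]
  have e2 : 1 - p.mu ≠ 0 := by linarith [h.mu_lt_one]
  have hc : ContinuousAt p.axialBound (1 / p.mu) := by
    unfold axialBound
    exact ContinuousAt.div (by fun_prop) (by fun_prop) (by positivity)
  have h0 : p.axialBound (1 / p.mu) = 0 := by
    have : p.F (1 / p.mu) = 0 := by simp [F, hmu.ne']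
    rw [axialBound, this]
    simp
  simpa only [ContinuousAt, h0] using hc

/-- Away from the poles the form is `F/G dx² + G/F² dφ²`; the first term is dropped and a factor
`1/(1-x²) ≥ 1` removed. At the poles the left side is zero. -/
lemma NonExtremal.sphereMetric_ge (h : p.NonExtremal) {n v : Fin 3 → ℝ}
    (hn : n 0 ^ 2 + n 1 ^ 2 + n 2 ^ 2 = 1) (hv : n 0 * v 0 + n 1 * v 1 + n 2 * v 2 = 0) :
    p.Gred (n 2) / (p.kappa ^ 2 * p.F (n 2) ^ 2) * (n 0 * v 1 - n 1 * v 0) ^ 2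
      ≤ p.sphereMetric n v v := by
  have hx : n 2 ≤ 1 := by nlinarith [sq_nonneg (n 0), sq_nonneg (n 1)]
  have e3 := h.F_pos hx
  have e4 := h.Gred_pos hx
  have e5 := h.kappa_pos
  have hP := h.axisPoly_eq (n 2)
  have hx2 : n 2 ^ 2 ≤ 1 := by nlinarith [sq_nonneg (n 0), sq_nonneg (n 1)]
  rcases hx2.eq_or_lt with h1 | h1
  · have n0 : n 0 = 0 := by nlinarith [sq_nonneg (n 0), sq_nonneg (n 1)]
    have n1 : n 1 = 0 := by nlinarith [sq_nonneg (n 0), sq_nonneg (n 1)]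
    have v2 : v 2 = 0 := by
      have : n 2 ≠ 0 := by intro h0; simp [h0] at h1
      simpa [n0, n1, this] using hv
    simp only [sphereMetric, n0, n1, v2]
    have : 0 ≤ p.Gred (n 2) / (p.kappa ^ 2 * p.F (n 2) ^ 2) * (v 0 * v 0 + v 1 * v 1) := by
      have := mul_self_nonneg (v 0)
      have := mul_self_nonneg (v 1)
      positivity
    simpa using this
  · have hd : 0 < 1 - n 2 ^ 2 := by linarith
    have key : (1 - n 2 ^ 2) * (v 0 * v 0 + v 1 * v 1 + v 2 * v 2) =
        (n 0 * v 1 - n 1 * v 0) ^ 2 + v 2 * v 2 := by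
      linear_combination (-(v 0 * v 0 + v 1 * v 1)) * hn +
        (n 0 * v 0 + n 1 * v 1 - n 2 * v 2) * hv
    have id : p.sphereMetric n v v = p.Gred (n 2) / (p.kappa ^ 2 * p.F (n 2) ^ 2) *
        (n 0 * v 1 - n 1 * v 0) ^ 2 / (1 - n 2 ^ 2) +
        p.F (n 2) * v 2 ^ 2 / (p.Gred (n 2) * (1 - n 2 ^ 2)) := by
      simp only [sphereMetric]
      field_simp
      linear_combination p.Gred (n 2) ^ 2 * key + (v 2 * v 2) * hP
    rw [id]
    have a1 : 0 ≤ p.F (n 2) * v 2 ^ 2 / (p.Gred (n 2) * (1 - n 2 ^ 2)) := by positivity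
    have a2 : p.Gred (n 2) / (p.kappa ^ 2 * p.F (n 2) ^ 2) * (n 0 * v 1 - n 1 * v 0) ^ 2 ≤
        p.Gred (n 2) / (p.kappa ^ 2 * p.F (n 2) ^ 2) *
        (n 0 * v 1 - n 1 * v 0) ^ 2 / (1 - n 2 ^ 2) :=
      le_div_self (by positivity) hd (by nlinarith [sq_nonneg (n 2)])
    linarith

/-- Near the singularity, `g(v, v)` is bounded below in terms of the momenta. -/
lemma NonExtremal.exists_metric_ge (h : p.NonExtremal) {q v : Fin 6 → ℝ} (hq : q ∈ p.region)
    (hv : q 3 * v 3 + q 4 * v 4 + q 5 * v 5 = 0) :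
    ∃ Z, 0 ≤ Z ∧
      Z - p.singBound (q 1) (p.metric q dt v) (p.metric q dpsi v) ≤ p.metric q v v ∧
      p.metric q (p.dphi q) v ^ 2 ≤ p.axialBound (q 1) * Z := by
  have hx := x_le_one hq
  have hx' := neg_one_le_x hq
  have hy := h.one_lt_y hq
  have e1 := h.F_neg hq.1
  have e2 := h.G_neg hy hq.2.1
  have e3 := h.F_pos hx
  have e4 := h.Gred_pos hx
  have e5 := h.kappa_pos
  have e6 : q 5 - q 1 < 0 := by linarith
  have hR := h.R_pos
  have hmu : 0 < 1 - p.mu := by linarith [h.mu_lt_one]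
  have hFx : 1 - p.mu ≤ p.F (q 5) := by
    have : 0 < p.mu := by linarith [h.nu_pos, h.nu_lt_lam, h.lam_lt_mu]
    simp only [F]; nlinarith
  have hGx : p.Gred (q 5) ≤ 4 := by
    obtain ⟨-, h1, h2, h3, h4, -⟩ := h
    simp only [Gred]
    have a1 : 1 - p.lam * q 5 ≤ 2 := by nlinarith
    have a2 : 1 - p.nu * q 5 ≤ 2 := by nlinarith
    have a3 : 0 ≤ 1 - p.nu * q 5 := by nlinarith
    nlinarith
  have hsph := h.sphereMetric_ge (n := ![q 3, q 4, q 5]) (v := ![v 3, v 4, v 5])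
    (by simpa using hq.2.2) (by simpa using hv)
  set S := p.sphereMetric ![q 3, q 4, q 5] ![v 3, v 4, v 5] ![v 3, v 4, v 5] with hS
  simp only [Matrix.cons_val] at hsph
  have hS0 : 0 ≤ S := le_trans (by positivity) hsph
  refine ⟨p.R ^ 2 * p.F (q 1) ^ 2 / (q 5 - q 1) ^ 2 * S, by positivity, ?_, ?_⟩
  -- This combination eliminates `v 0`, so `v 2` is expressed by the momenta.
  · have hpsi : p.metric q dpsi v - p.R * p.C * (1 + q 1) * p.metric q dt v =
        -(p.R ^ 2 / (q 5 - q 1) ^ 2 * p.F (q 5) * (p.G (q 1) / p.F (q 1)) * v 2) := by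
      simp [metric_apply, dpsi, dt]
      ring
    have hm : p.metric q v v = -(p.F (q 5) / p.F (q 1)) *
        (v 0 + p.R * p.C * (1 + q 1) * v 2) ^ 2
        + p.R ^ 2 / (q 5 - q 1) ^ 2 * p.F (q 5) * (p.F (q 1) ^ 2 / -p.G (q 1)) * v 1 ^ 2
        - p.R ^ 2 / (q 5 - q 1) ^ 2 * p.F (q 5) * (p.G (q 1) / p.F (q 1)) * v 2 ^ 2
        + p.R ^ 2 * p.F (q 1) ^ 2 / (q 5 - q 1) ^ 2 * S := by
      rw [hS]
      simp only [metric]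
      rw [div_neg]
      ring
    have b1 : 0 ≤ -(p.F (q 5) / p.F (q 1)) * (v 0 + p.R * p.C * (1 + q 1) * v 2) ^ 2 :=
      mul_nonneg (neg_nonneg.2 (div_neg_of_pos_of_neg e3 e1).le) (sq_nonneg _)
    have b2 : 0 ≤ p.R ^ 2 / (q 5 - q 1) ^ 2 * p.F (q 5) * (p.F (q 1) ^ 2 / -p.G (q 1)) *
        v 1 ^ 2 := by
      have : 0 < -p.G (q 1) := by linarith
      positivity
    have b3 : p.R ^ 2 / (q 5 - q 1) ^ 2 * p.F (q 5) * (p.G (q 1) / p.F (q 1)) * v 2 ^ 2 ≤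
        p.singBound (q 1) (p.metric q dt v) (p.metric q dpsi v) := by
      have hGF : 0 < p.G (q 1) / p.F (q 1) := div_pos_of_neg_of_neg e2 e1
      -- The dependence on `x` is removed by `|x - y| ≤ 1 + y` and `F(x) ≥ 1 - μ`.
      have c1 : (q 5 - q 1) ^ 2 / p.F (q 5) ≤ (1 + q 1) ^ 2 / (1 - p.mu) :=
        div_le_div₀ (by positivity) (by nlinarith) hmu hFx
      have c2 : p.R ^ 2 / (q 5 - q 1) ^ 2 * p.F (q 5) * (p.G (q 1) / p.F (q 1)) * v 2 ^ 2 =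
          (q 5 - q 1) ^ 2 / p.F (q 5) * (p.R ^ 2 / (q 5 - q 1) ^ 4 * p.F (q 5) ^ 2 *
            (p.G (q 1) / p.F (q 1)) * v 2 ^ 2) := by
        have := e6.ne
        field_simp
      have c3 : p.singBound (q 1) (p.metric q dt v) (p.metric q dpsi v) =
          (1 + q 1) ^ 2 / (1 - p.mu) * (p.R ^ 2 / (q 5 - q 1) ^ 4 * p.F (q 5) ^ 2 *
            (p.G (q 1) / p.F (q 1)) * v 2 ^ 2) := by
        rw [singBound, hpsi]
        have := e6.ne
        have := e1.ne
        have := e2.ne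
        field_simp
      rw [c2, c3]
      have : 0 ≤ p.R ^ 2 / (q 5 - q 1) ^ 4 * p.F (q 5) ^ 2 *
          (p.G (q 1) / p.F (q 1)) * v 2 ^ 2 := by
        have := e6.ne
        positivity
      gcongr
    linarith
  · set w := q 3 * v 4 - q 4 * v 3 with hw
    have hphi : p.metric q (p.dphi q) v = p.R ^ 2 * p.F (q 1) ^ 2 / (q 5 - q 1) ^ 2 *
        (p.kappa * (p.Gred (q 5) / (p.kappa ^ 2 * p.F (q 5) ^ 2)) * w) := by
      simp [metric_apply, dphi, hw]
      ring
    set E := p.Gred (q 5) / (p.kappa ^ 2 * p.F (q 5) ^ 2) with hE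
    set B := p.R ^ 2 * p.F (q 1) ^ 2 / (q 5 - q 1) ^ 2 with hB
    have hB0 : 0 ≤ B := by positivity
    have hE0 : 0 ≤ E := by positivity
    -- The bounds are `Gred(x) ≤ 4`, `y - x ≥ y - 1` and `F(x) ≥ 1 - μ`.
    have d1 : B * p.kappa ^ 2 * E ≤ p.axialBound (q 1) := by
      have : B * p.kappa ^ 2 * E = p.Gred (q 5) * p.R ^ 2 * p.F (q 1) ^ 2 /
          ((q 1 - q 5) ^ 2 * p.F (q 5) ^ 2) := by
        rw [hB, hE, show (q 5 - q 1) ^ 2 = (q 1 - q 5) ^ 2 by ring]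
        field_simp
      rw [this, axialBound]
      have z : 0 < q 1 - 1 := by linarith
      gcongr
    calc p.metric q (p.dphi q) v ^ 2 = B * p.kappa ^ 2 * E * (B * (E * w ^ 2)) := by
          rw [hphi]; ring
      _ ≤ p.axialBound (q 1) * (B * S) := by
          have := axialBound_nonneg (p := p) (q 1)
          gcongr

/-- The conserved quantities at `s` obey the bounds at every `r` in `I`; passing to the limit in `r`
removes the right-hand sides. -/
lemma ReachesSingularity.causal_momenta (h : p.NonExtremal) {I : Set ℝ} {γ : ℝ → Fin 6 → ℝ}
    (hI : IsOpen I) (hc : I.OrdConnected) (hne : I.Nonempty) (hg : p.IsGeodesicOn γ I)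
    (hcausal : ∀ s ∈ I, p.speedSq γ s ≤ 0) (hr : p.ReachesSingularity γ I) {s : ℝ} (hs : s ∈ I) :
    p.speedSq γ s = 0 ∧ p.pphi γ s = 0 := by
  have : Nonempty I := hne.to_subtype
  have hN : Tendsto (fun r : I => p.singBound (γ r 1) (p.pt γ s) (p.ppsi γ s)) atTop (𝓝 0) :=
    (h.tendsto_singBound _ _).comp hr
  have hM : Tendsto (fun r : I => p.axialBound (γ r 1)) atTop (𝓝 0) :=
    h.tendsto_axialBound.comp hr
  have key : ∀ r : I, -p.singBound (γ r 1) (p.pt γ s) (p.ppsi γ s) ≤ p.speedSq γ s ∧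
      p.pphi γ s ^ 2 ≤
        p.axialBound (γ r 1) * p.singBound (γ r 1) (p.pt γ s) (p.ppsi γ s) := by
    rintro ⟨r, hrI⟩
    rw [const_of_hasDerivAt_zero hI hc (fun s hs => hg.hasDerivAt_pt hs) hs hrI,
      const_of_hasDerivAt_zero hI hc (fun s hs => hg.hasDerivAt_ppsi hs) hs hrI,
      const_of_hasDerivAt_zero hI hc (fun s hs => hg.hasDerivAt_pphi hs) hs hrI,
      const_of_hasDerivAt_zero hI hc (fun s hs => hg.hasDerivAt_speedSq h hI hs) hs hrI]
    obtain ⟨Z, hZ0, hZ1, hZ2⟩ := h.exists_metric_ge (hg.1 r hrI) (hg.sphere_tangent hI hrI)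
    have hle := hcausal r hrI
    simp only [speedSq, pt, ppsi, pphi] at *
    exact ⟨by linarith, hZ2.trans
      (mul_le_mul_of_nonneg_left (by linarith) (axialBound_nonneg _))⟩
  constructor
  · refine le_antisymm (hcausal s hs) ?_
    have := hN.neg
    rw [neg_zero] at this
    exact le_of_tendsto this (Eventually.of_forall fun r => (key r).1)
  · have := hM.mul hN
    rw [zero_mul] at this
    have := ge_of_tendsto this (Eventually.of_forall fun r => (key r).2)
    exact pow_eq_zero_iff two_ne_zero |>.1 (le_antisymm this (sq_nonneg _))

end DipoleRing.Params

namespace DipoleRing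

/-! ### Radial motion in finite time -/

/-- The separable equation `w' = -1 / h(w)`, which runs into the zero of `h` in finite time. -/
lemma exists_separable_solution {h : ℝ → ℝ} (hc : Continuous h) (h0 : ∀ u, 0 ≤ h u)
    (hpos : ∀ u, u ≠ 0 → 0 < h u) {w₀ W : ℝ} (hw₀ : 0 < w₀) (hW : w₀ < W) :
    ∃ (a b : ℝ) (w : ℝ → ℝ), a < 0 ∧ 0 < b ∧ w 0 = w₀ ∧
      (∀ s ∈ Set.Ioo a b, 0 < w s ∧ w s < W ∧ HasDerivAt w (-(1 / h (w s))) s) ∧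
      Tendsto w (𝓝[<] b) (𝓝 0) := by
  -- The solution is `w(s) = H⁻¹(H(w₀) - s)`; it is at `W` for `s = a` and at `0` for `s = b`.
  set H : ℝ → ℝ := fun w => ∫ u in (0 : ℝ)..w, h u with hH
  have hder : ∀ w, HasDerivAt H (h w) w := fun w => (hc.integral_hasStrictDerivAt 0 w).hasDerivAt
  have hHc : Continuous H := continuous_iff_continuousAt.2 fun w => (hder w).continuousAt
  have hmono : StrictMono H := by
    intro a b hab
    have : 0 < ∫ u in a..b, h u := by
      refine intervalIntegral.integral_pos hab hc.continuousOn (fun u _ => h0 u) ?_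
      -- Since `h` may vanish at `0`, the endpoint where it is positive is chosen to be nonzero.
      by_cases ha : a = 0
      · exact ⟨b, Set.right_mem_Icc.2 hab.le, hpos b (by linarith)⟩
      · exact ⟨a, Set.left_mem_Icc.2 hab.le, hpos a ha⟩
    have h2 := intervalIntegral.integral_add_adjacent_intervals
      (hc.intervalIntegrable (μ := MeasureTheory.volume) 0 a) (hc.intervalIntegrable a b)
    simp only [hH]
    linarith
  have hrange : IsOpen (Set.range H) := by
    refine isOpen_iff_mem_nhds.2 ?_
    rintro _ ⟨w, rfl⟩
    exact mem_of_superset (Ioo_mem_nhds (hmono (sub_one_lt w)) (hmono (lt_add_one w)))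
      ((intermediate_value_Ioo (by linarith) hHc.continuousOn).trans (Set.image_subset_range _ _))
  have hopen : IsOpenEmbedding H :=
    ⟨hmono.isEmbedding_of_ordConnected (isPreconnected_range hHc).ordConnected, hrange⟩
  set e := hopen.toOpenPartialHomeomorph H with he
  have hsymm : ∀ w, e.symm (H w) = w := fun w => hopen.toOpenPartialHomeomorph_left_inv H
  have htarget : ∀ w, H w ∈ e.target := fun w => e.map_source (x := w) (by simp [he])
  refine ⟨H w₀ - H W, H w₀ - H 0, fun s => e.symm (H w₀ - s), sub_neg.2 (hmono hW),
    sub_pos.2 (hmono hw₀), by simp [hsymm], ?_, ?_⟩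
  · rintro s ⟨hs1, hs2⟩
    obtain ⟨w, ⟨hw1, hw2⟩, hw⟩ := intermediate_value_Ioo (hw₀.trans hW).le hHc.continuousOn
      (show H w₀ - s ∈ Set.Ioo (H 0) (H W) from ⟨by linarith, by linarith⟩)
    have hws : e.symm (H w₀ - s) = w := by rw [← hw, hsymm]
    simp only [hws]
    refine ⟨hw1, hw2, ?_⟩
    have h1 : HasDerivAt e.symm (h w)⁻¹ (H w₀ - s) := by
      refine e.hasDerivAt_symm (hw ▸ htarget w) (hpos w hw1.ne').ne' ?_
      rw [hws]
      exact hder w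
    have := h1.comp s ((hasDerivAt_id s).const_sub (H w₀))
    refine this.congr_deriv (by simp)
  -- Only continuity of the inverse is used here: it need not be differentiable at `H 0`, where `h`
  -- may vanish.
  · have h1 : ContinuousAt e.symm (H 0) := e.symm.continuousAt (htarget 0)
    have h2 : ContinuousAt (fun s => e.symm (H w₀ - s)) (H w₀ - H 0) :=
      ContinuousAt.comp (g := e.symm) (by simpa using h1) (by fun_prop)
    have h3 := h2.tendsto
    simp only [sub_sub_cancel, hsymm] at h3
    exact h3.mono_left nhdsWithin_le_nhds

lemma exists_hasDerivAt_of_continuousOn_Ioo {a b : ℝ} {f : ℝ → ℝ}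
    (hf : ContinuousOn f (Set.Ioo a b)) (ha : a < 0) (hb : 0 < b) (c : ℝ) :
    ∃ Φ : ℝ → ℝ, Φ 0 = c ∧ ∀ s ∈ Set.Ioo a b, HasDerivAt Φ (f s) s := by
  refine ⟨fun s => c + ∫ u in (0 : ℝ)..s, f u, by simp, fun s hs => ?_⟩
  refine HasDerivAt.const_add c (intervalIntegral.integral_hasDerivAt_right ?_ ?_ ?_)
  · exact (hf.mono (Set.ordConnected_Ioo.uIcc_subset ⟨ha, hb⟩ hs)).intervalIntegrable
  · exact hf.stronglyMeasurableAtFilter isOpen_Ioo s hs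
  · exact hf.continuousAt (isOpen_Ioo.mem_nhds hs)

namespace Params

variable {p : Params}

/-- The radial motion of the zero-energy null geodesics. -/
lemma NonExtremal.exists_radial_motion (h : p.NonExtremal) {x K y₀ : ℝ} (hx : x ≤ 1) (hK : 0 < K)
    (hy : 1 / p.mu < y₀) (hy' : y₀ < 1 / p.lam) :
    ∃ (a b : ℝ) (y : ℝ → ℝ), a < 0 ∧ 0 < b ∧ y 0 = y₀ ∧
      (∀ s ∈ Set.Ioo a b, 1 / p.mu < y s ∧ y s < 1 / p.lam ∧
        HasDerivAt y (-(K * (x - y s) ^ 2 / √(-p.F (y s)))) s) ∧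
      Tendsto y (𝓝[<] b) (𝓝 (1 / p.mu)) := by
  have hmu : 0 < p.mu := by linarith [h.nu_pos, h.nu_lt_lam, h.lam_lt_mu]
  have hF : 0 < 1 - p.mu * x := h.F_pos hx
  have hd : ∀ u : ℝ, 0 < 1 + u ^ 2 - p.mu * x := fun u => by nlinarith [sq_nonneg u]
  have hF0 : 0 < p.mu * y₀ - 1 := by
    have := h.F_neg hy
    simp only [F] at this
    linarith
  have hW : p.mu * y₀ - 1 < p.mu * (1 / p.lam) - 1 := by gcongr
  -- Substituting `y = (1 + w²)/μ`, so that `-F(y) = w²`, turns the radial equation into `w' =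
  -- -1/h(w)` with this `h`. The upper limit for `w` corresponds to the inner horizon.
  obtain ⟨a, b, w, ha, hb, hw0, hw, hlim⟩ := exists_separable_solution
    (h := fun u => 2 * p.mu * u ^ 2 / (K * (1 + u ^ 2 - p.mu * x) ^ 2))
    (by
      refine Continuous.div (by fun_prop) (by fun_prop) fun u => ?_
      have := hd u
      positivity)
    (fun u => by positivity) (fun u hu => by have := hd u; positivity)
    (Real.sqrt_pos.2 hF0) (Real.sqrt_lt_sqrt hF0.le hW)
  refine ⟨a, b, fun s => (1 + w s ^ 2) / p.mu, ha, hb, ?_, fun s hs => ?_, ?_⟩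
  · simp only [hw0, Real.sq_sqrt hF0.le]
    field_simp
    ring
  · obtain ⟨h1, h2, h3⟩ := hw s hs
    have hsq : w s ^ 2 < p.mu * (1 / p.lam) - 1 := (Real.lt_sqrt h1.le).1 h2
    refine ⟨?_, ?_, ?_⟩
    · exact div_lt_div_of_pos_right (lt_add_of_pos_right 1 (by positivity)) hmu
    · rw [div_lt_iff₀ hmu]
      linarith
    · have hr : √(-p.F ((1 + w s ^ 2) / p.mu)) = w s := by
        rw [show -p.F ((1 + w s ^ 2) / p.mu) = w s ^ 2 by simp only [F]; field_simp; ring]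
        exact Real.sqrt_sq h1.le
      refine (((h3.pow 2).const_add 1).div_const p.mu).congr_deriv ?_
      rw [hr]
      have := (hd (w s)).ne'
      simp only [Nat.cast_ofNat]
      field_simp
      ring
  · have := ((hlim.pow 2).const_add 1).div_const p.mu
    simpa using this

end Params
end DipoleRing

namespace DipoleRing.Params

variable {p : Params}

/-! ### Zero-energy null geodesics -/

variable (p) in
/-- The velocity of the null geodesics with `p_t = 0`, `p_φ = 0`, `p_ψ = P` along which the point
of the sphere is constant. -/
noncomputable def zeroEnergyVel (P x y : ℝ) : Fin 6 → ℝ :=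
  ![p.R * p.C * (1 + y) * ((x - y) ^ 2 * p.F y / (p.R ^ 2 * p.F x * p.G y) * P),
    -(|P| / (p.R ^ 2 * p.F x) * (x - y) ^ 2 / √(-p.F y)),
    -((x - y) ^ 2 * p.F y / (p.R ^ 2 * p.F x * p.G y) * P), 0, 0, 0]

section ZeroEnergy

variable {q : Fin 6 → ℝ} (P : ℝ)

/-- The vector stays null when only `y` is kept and `x` varies, since the two expressions that
multiply functions of `x` vanish separately. Hence the Lagrangian has zero derivative along `n₃`. -/
lemma NonExtremal.metric_zeroEnergyVel_self (h : p.NonExtremal) (hq : q ∈ p.region)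
    {q' : Fin 6 → ℝ} (hq' : q' 1 = q 1) :
    p.metric q' (p.zeroEnergyVel P (q 5) (q 1)) (p.zeroEnergyVel P (q 5) (q 1)) = 0 := by
  have e1 := h.F_neg hq.1
  have e2 := (h.G_neg (h.one_lt_y hq) hq.2.1).ne
  have e3 := (h.F_pos (x_le_one hq)).ne'
  have e4 := h.R_pos.ne'
  have hs : 0 < √(-p.F (q 1)) := Real.sqrt_pos.2 (by linarith)
  have hF : p.F (q 1) = -√(-p.F (q 1)) ^ 2 := by rw [Real.sq_sqrt (by linarith)]; ring
  rw [metric_apply, hq']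
  simp only [zeroEnergyVel, Matrix.cons_val]
  generalize √(-p.F (q 1)) = ρ at *
  rw [hF]
  have : p.G (q 1) / -ρ ^ 2 *
      (-((q 5 - q 1) ^ 2 * -ρ ^ 2 / (p.R ^ 2 * p.F (q 5) * p.G (q 1)) * P) *
        -((q 5 - q 1) ^ 2 * -ρ ^ 2 / (p.R ^ 2 * p.F (q 5) * p.G (q 1)) * P)) +
      (-ρ ^ 2) ^ 2 / p.G (q 1) * (-(|P| / (p.R ^ 2 * p.F (q 5)) * (q 5 - q 1) ^ 2 / ρ) *
        -(|P| / (p.R ^ 2 * p.F (q 5)) * (q 5 - q 1) ^ 2 / ρ)) = 0 := by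
    field_simp
    rw [sq_abs]
    ring
  rw [this]
  ring

lemma metric_dt_zeroEnergyVel :
    p.metric q (Pi.single 0 1) (p.zeroEnergyVel P (q 5) (q 1)) = 0 := by
  simp [metric_apply, zeroEnergyVel]

lemma NonExtremal.metric_dy_zeroEnergyVel (h : p.NonExtremal) (hq : q ∈ p.region) :
    p.metric q (Pi.single 1 1) (p.zeroEnergyVel P (q 5) (q 1)) =
      |P| * (√(-p.F (q 1)) ^ 3 / p.G (q 1)) := by
  have e1 := h.F_neg hq.1
  have e2 := (h.G_neg (h.one_lt_y hq) hq.2.1).ne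
  have e3 := (h.F_pos (x_le_one hq)).ne'
  have e4 := h.R_pos.ne'
  have e6 : q 5 - q 1 ≠ 0 := by linarith [x_le_one hq, h.one_lt_y hq]
  have hs : 0 < √(-p.F (q 1)) := Real.sqrt_pos.2 (by linarith)
  have hF : p.F (q 1) = -√(-p.F (q 1)) ^ 2 := by rw [Real.sq_sqrt (by linarith)]; ring
  simp [metric_apply, zeroEnergyVel]
  generalize √(-p.F (q 1)) = ρ at *
  rw [hF]
  field_simp

lemma NonExtremal.metric_dpsi_zeroEnergyVel (h : p.NonExtremal) (hq : q ∈ p.region) :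
    p.metric q (Pi.single 2 1) (p.zeroEnergyVel P (q 5) (q 1)) = P := by
  have e1 := (h.F_neg hq.1).ne
  have e2 := (h.G_neg (h.one_lt_y hq) hq.2.1).ne
  have e3 := (h.F_pos (x_le_one hq)).ne'
  have e4 := h.R_pos.ne'
  have e6 : q 5 - q 1 ≠ 0 := by linarith [x_le_one hq, h.one_lt_y hq]
  simp [metric_apply, zeroEnergyVel]
  field_simp

lemma metric_sphere_zeroEnergyVel {u : Fin 6 → ℝ} (h0 : u 0 = 0) (h1 : u 1 = 0) (h2 : u 2 = 0) :
    p.metric q u (p.zeroEnergyVel P (q 5) (q 1)) = 0 := by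
  simp [metric_apply, zeroEnergyVel, h0, h1, h2]

lemma hasDerivAt_F (y : ℝ) : HasDerivAt p.F (-p.mu) y :=
  (((hasDerivAt_id y).const_mul p.mu).const_sub 1).congr_deriv (by simp)

lemma NonExtremal.hasDerivAt_sqrt_F (h : p.NonExtremal) {y : ℝ} (hy : 1 / p.mu < y) :
    HasDerivAt (fun y => √(-p.F y)) (p.mu / (2 * √(-p.F y))) y :=
  ((hasDerivAt_F y).fun_neg.congr_deriv (neg_neg _)).sqrt (by linarith [h.F_neg hy])

/-- The radial Euler–Lagrange equation for `zeroEnergyVel`. -/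
lemma NonExtremal.lineDeriv_dy_zeroEnergyVel (h : p.NonExtremal) (hq : q ∈ p.region) :
    ∃ D, HasDerivAt (fun y => |P| * (√(-p.F y) ^ 3 / p.G y)) D (q 1) ∧
      lineDeriv ℝ (fun q' => p.metric q' (p.zeroEnergyVel P (q 5) (q 1))
        (p.zeroEnergyVel P (q 5) (q 1)) / 2) q (Pi.single 1 1) =
          D * p.zeroEnergyVel P (q 5) (q 1) 1 := by
  have e1 := h.F_neg hq.1
  have e2 := (h.G_neg (h.one_lt_y hq) hq.2.1).ne
  have e3 := (h.F_pos (x_le_one hq)).ne'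
  have e4 := h.R_pos.ne'
  have e6 : q 5 - q 1 ≠ 0 := by linarith [x_le_one hq, h.one_lt_y hq]
  have hG : HasDerivAt p.G (deriv p.G (q 1)) (q 1) := (differentiable_G _).hasDerivAt
  have hF := hasDerivAt_F (p := p) (q 1)
  have hs : 0 < √(-p.F (q 1)) := Real.sqrt_pos.2 (by linarith)
  have hFs : p.F (q 1) = -√(-p.F (q 1)) ^ 2 := by rw [Real.sq_sqrt (by linarith)]; ring
  refine ⟨_, (((h.hasDerivAt_sqrt_F hq.1).pow 3).div hG e2).const_mul |P|, ?_⟩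
  set V := p.zeroEnergyVel P (q 5) (q 1) with hV
  -- The first term of the metric contains this expression squared, so its derivative vanishes with
  -- `hA0`. By `hB0` the derivative of the conformal factor also drops out and need not be computed.
  have hA : HasDerivAt (fun y => V 0 + p.R * p.C * (1 + y) * V 2) (p.R * p.C * 1 * V 2) (q 1) :=
    ((((hasDerivAt_id (q 1)).const_add 1).const_mul _).mul_const _).const_add _
  have hA0 : V 0 + p.R * p.C * (1 + q 1) * V 2 = 0 := by
    simp [hV, zeroEnergyVel]
  have hB := ((hG.div hF e1.ne).mul_const (V 2 * V 2)).add
    (((hF.pow 2).div hG e2).mul_const (V 1 * V 1))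
  have hB0 : p.G (q 1) / p.F (q 1) * (V 2 * V 2) + p.F (q 1) ^ 2 / p.G (q 1) * (V 1 * V 1) = 0 := by
    simp only [hV, zeroEnergyVel, Matrix.cons_val]
    generalize √(-p.F (q 1)) = ρ at *
    rw [hFs]
    field_simp
    rw [sq_abs]
    ring
  have hc : HasDerivAt (fun y => p.R ^ 2 / (q 5 - y) ^ 2)
      (deriv (fun y => p.R ^ 2 / (q 5 - y) ^ 2) (q 1)) (q 1) := by
    refine DifferentiableAt.hasDerivAt (DifferentiableAt.div (by fun_prop) (by fun_prop) ?_)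
    positivity
  have hL := (((((hasDerivAt_const (q 1) (p.F (q 5))).div hF e1.ne).neg.mul (hA.mul hA)).add
    (hc.mul (hB.const_mul (-(p.F (q 5)))))).div_const 2)
  have hline := HasDerivAt.comp_const_add (q 1) 0 (by rw [add_zero]; exact hL)
  rw [lineDeriv]
  refine (HasDerivAt.deriv (hline.congr_of_eventuallyEq (Eventually.of_forall fun t => ?_))).trans ?_
  · have hz : V 3 = 0 ∧ V 4 = 0 ∧ V 5 = 0 := by simp [hV, zeroEnergyVel]
    simp [metric_apply, hz]
  · simp only [Pi.mul_apply, Pi.add_apply, Pi.neg_apply, Pi.div_apply, Pi.pow_apply, hA0, hB0]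
    simp only [hV, zeroEnergyVel, Matrix.cons_val]
    generalize √(-p.F (q 1)) = ρ at *
    rw [hFs]
    push_cast
    field_simp
    rw [sq_abs]
    ring

lemma NonExtremal.differentiableAt_zeroEnergyVel (h : p.NonExtremal) (hq : q ∈ p.region) :
    DifferentiableAt ℝ (p.zeroEnergyVel P (q 5)) (q 1) := by
  have e1 := h.F_neg hq.1
  have e2 := (h.G_neg (h.one_lt_y hq) hq.2.1).ne
  have e3 := (h.F_pos (x_le_one hq)).ne'
  have e4 := h.R_pos.ne'
  have hs : √(-p.F (q 1)) ≠ 0 := (Real.sqrt_pos.2 (by linarith)).ne'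
  have n : p.R ^ 2 * p.F (q 5) * p.G (q 1) ≠ 0 := by positivity
  have dF : DifferentiableAt ℝ p.F (q 1) := differentiable_F _
  have dG : DifferentiableAt ℝ p.G (q 1) := differentiable_G _
  have dS : DifferentiableAt ℝ (fun y => √(-p.F y)) (q 1) :=
    (h.hasDerivAt_sqrt_F hq.1).differentiableAt
  refine differentiableAt_pi.2 fun k => ?_
  fin_cases k
  · change DifferentiableAt ℝ (fun y => p.R * p.C * (1 + y) * ((q 5 - y) ^ 2 * p.F y /
      (p.R ^ 2 * p.F (q 5) * p.G y) * P)) (q 1)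
    fun_prop (disch := assumption)
  · change DifferentiableAt ℝ (fun y => -(|P| / (p.R ^ 2 * p.F (q 5)) * (q 5 - y) ^ 2 /
      √(-p.F y))) (q 1)
    exact (DifferentiableAt.div (by fun_prop) dS hs).neg
  · change DifferentiableAt ℝ (fun y => -((q 5 - y) ^ 2 * p.F y /
      (p.R ^ 2 * p.F (q 5) * p.G y) * P)) (q 1)
    fun_prop (disch := assumption)
  all_goals exact differentiableAt_const _

end ZeroEnergy

/-- The sphere point is constant and its momenta vanish, so the constraint multiplier is `0` and the
axes need no separate treatment. -/
lemma NonExtremal.exists_zeroEnergy_geodesic (h : p.NonExtremal) {q : Fin 6 → ℝ}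
    (hq : q ∈ p.region) {P : ℝ} (hP : P ≠ 0) :
    ∃ (a b : ℝ) (γ : ℝ → Fin 6 → ℝ), a < 0 ∧ 0 < b ∧ γ 0 = q ∧
      p.IsGeodesicOn γ (Set.Ioo a b) ∧ p.IsNullOn γ (Set.Ioo a b) ∧
      (∀ s ∈ Set.Ioo a b, p.pt γ s = 0 ∧ p.pphi γ s = 0 ∧ p.ppsi γ s = P) ∧
      p.ReachesSingularity γ (Set.Ioo a b) := by
  have hx := x_le_one hq
  have hFx := h.F_pos hx
  have hR := h.R_pos
  obtain ⟨a, b, y, ha, hb, hy0, hy, hlim⟩ := h.exists_radial_motion (K := |P| / (p.R ^ 2 * p.F (q 5)))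
    hx (by positivity) hq.1 hq.2.1
  set V : ℝ → Fin 6 → ℝ := fun s => p.zeroEnergyVel P (q 5) (y s) with hV
  have hreg : ∀ s ∈ Set.Ioo a b, ∀ t ψ, ![t, y s, ψ, q 3, q 4, q 5] ∈ p.region :=
    fun s hs t ψ => ⟨(hy s hs).1, (hy s hs).2.1, hq.2.2⟩
  have hVd : ∀ s ∈ Set.Ioo a b, DifferentiableAt ℝ V s := fun s hs =>
    DifferentiableAt.comp s (h.differentiableAt_zeroEnergyVel P (hreg s hs 0 0))
      (hy s hs).2.2.differentiableAt
  have hVc : ∀ k, ContinuousOn (fun s => V s k) (Set.Ioo a b) := fun k s hs =>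
    (differentiableAt_pi.1 (hVd s hs) k).continuousAt.continuousWithinAt
  obtain ⟨T, hT0, hT⟩ := exists_hasDerivAt_of_continuousOn_Ioo (hVc 0) ha hb (q 0)
  obtain ⟨Ψ, hΨ0, hΨ⟩ := exists_hasDerivAt_of_continuousOn_Ioo (hVc 2) ha hb (q 2)
  set γ : ℝ → Fin 6 → ℝ := fun s => ![T s, y s, Ψ s, q 3, q 4, q 5] with hγ
  have hder : ∀ s ∈ Set.Ioo a b, HasDerivAt γ (V s) s := by
    intro s hs
    refine hasDerivAt_pi.2 fun k => ?_
    fin_cases k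
    · exact hT s hs
    · exact (hy s hs).2.2
    · exact hΨ s hs
    all_goals exact hasDerivAt_const _ _
  have hd : ∀ s ∈ Set.Ioo a b, deriv γ s = p.zeroEnergyVel P (γ s 5) (γ s 1) :=
    fun s hs => (hder s hs).deriv
  have hγr : ∀ s ∈ Set.Ioo a b, γ s ∈ p.region := fun s hs => hreg s hs _ _
  have hnhds : ∀ s ∈ Set.Ioo a b, ∀ᶠ r in 𝓝 s, r ∈ Set.Ioo a b :=
    fun s hs => isOpen_Ioo.mem_nhds hs
  refine ⟨a, b, γ, ha, hb, ?_, ⟨hγr, ?_, 0, ?_⟩, ?_, ?_, ?_⟩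
  · funext k
    fin_cases k
    · exact hT0
    · exact hy0
    · exact hΨ0
    all_goals rfl
  · refine fun s hs => ⟨(hder s hs).differentiableAt, (hVd s hs).congr_of_eventuallyEq ?_⟩
    filter_upwards [hnhds s hs] with r hr using (hder r hr).deriv
  · intro s hs k
    have hconst : ∀ c, (∀ r ∈ Set.Ioo a b,
        p.metric (γ r) (Pi.single k 1) (p.zeroEnergyVel P (γ r 5) (γ r 1)) = c) →
        HasDerivAt (fun r => p.metric (γ r) (Pi.single k 1) (deriv γ r)) 0 s := fun c hc =>
      (hasDerivAt_const s c).congr_of_eventuallyEq (by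
        filter_upwards [hnhds s hs] with r hr
        rw [hd r hr, hc r hr])
    simp only [Pi.zero_apply, zero_mul, add_zero]
    by_cases h1 : k = 1
    · subst h1
      obtain ⟨D, hD, hD'⟩ := h.lineDeriv_dy_zeroEnergyVel P (hγr s hs)
      rw [hd s hs, hD']
      -- The radial momentum is a function of `y` alone, so its rate is `D` times `y'`.
      refine (hD.comp s (hy s hs).2.2).congr_of_eventuallyEq ?_
      filter_upwards [hnhds s hs] with r hr
      rw [hd r hr, h.metric_dy_zeroEnergyVel P (hγr r hr)]
      rfl
    by_cases h5 : k = 5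
    · subst h5
      have : (fun t : ℝ => p.metric (γ s + t • Pi.single 5 1) (deriv γ s) (deriv γ s) / 2) =
          fun _ => 0 := by
        funext t
        rw [hd s hs, h.metric_zeroEnergyVel_self P (hγr s hs) (by simp), zero_div]
      rw [lineDeriv, this, deriv_const]
      exact hconst 0 fun r _ => metric_sphere_zeroEnergyVel P (by simp) (by simp) (by simp)
    rw [lineDeriv_metric_eq_zero _ _ _ h1 h5]
    by_cases h2 : k = 2
    · subst h2
      exact hconst P fun r hr => h.metric_dpsi_zeroEnergyVel P (hγr r hr)
    by_cases h0 : k = 0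
    · subst h0
      exact hconst 0 fun r _ => metric_dt_zeroEnergyVel P
    exact hconst 0 fun r _ => metric_sphere_zeroEnergyVel P (by simp [Ne.symm h0])
      (by simp [Ne.symm h1]) (by simp [Ne.symm h2])
  · refine fun s hs => ⟨fun h0 => ?_, ?_⟩
    · have h1 := congrFun h0 1
      rw [hd s hs] at h1
      have hF := h.F_neg (hγr s hs).1
      have hs' : 0 < √(-p.F (γ s 1)) := Real.sqrt_pos.2 (by linarith)
      have hxy : γ s 5 - γ s 1 ≠ 0 := by linarith [x_le_one (hγr s hs), h.one_lt_y (hγr s hs)]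
      have hFx := h.F_pos (x_le_one (hγr s hs))
      have : 0 < |P| / (p.R ^ 2 * p.F (γ s 5)) * (γ s 5 - γ s 1) ^ 2 / √(-p.F (γ s 1)) := by
        positivity
      simp only [zeroEnergyVel, Matrix.cons_val, Pi.zero_apply] at h1
      linarith
    · rw [speedSq, hd s hs]
      exact h.metric_zeroEnergyVel_self P (hγr s hs) rfl
  · intro s hs
    rw [pt, pphi, ppsi, hd s hs]
    exact ⟨metric_dt_zeroEnergyVel P, metric_sphere_zeroEnergyVel P rfl rfl rfl,
      h.metric_dpsi_zeroEnergyVel P (hγr s hs)⟩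
  · exact (tendsto_comp_coe_Ioo_atTop (ha.trans hb)).2 hlim


end DipoleRing.Params

theorem mainTheorem5 (p : DipoleRing.Params) (hp : p.NonExtremal) :
    (∀ (I : Set ℝ) (γ : ℝ → Fin 6 → ℝ), IsOpen I → I.OrdConnected → I.Nonempty →
      p.IsGeodesicOn γ I → p.IsCausalOn γ I → p.ReachesSingularity γ I →
        p.IsNullOn γ I ∧ ∀ s ∈ I, p.pphi γ s = 0) ∧
    (∀ (I : Set ℝ) (γ : ℝ → Fin 6 → ℝ), IsOpen I → I.OrdConnected → I.Nonempty →
      p.IsGeodesicOn γ I → p.IsTimelikeOn γ I → ¬ p.ReachesSingularity γ I) ∧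
    (∀ q ∈ p.region, ∀ P : ℝ, P ≠ 0 →
      ∃ (a b : ℝ) (γ : ℝ → Fin 6 → ℝ), a < 0 ∧ 0 < b ∧ γ 0 = q ∧
        p.IsGeodesicOn γ (Set.Ioo a b) ∧ p.IsNullOn γ (Set.Ioo a b) ∧
        (∀ s ∈ Set.Ioo a b, p.pt γ s = 0 ∧ p.pphi γ s = 0 ∧ p.ppsi γ s = P) ∧
        p.ReachesSingularity γ (Set.Ioo a b)) := by
  refine ⟨fun I γ hI hc hne hg hcausal hr => ?_, fun I γ hI hc hne hg htime hr => ?_,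
    fun q hq P hP => hp.exists_zeroEnergy_geodesic hq hP⟩
  · have key := fun s hs => DipoleRing.Params.ReachesSingularity.causal_momenta (s := s) hp hI hc
      hne hg (fun r hr => (hcausal r hr).2) hr hs
    exact ⟨fun s hs => ⟨(hcausal s hs).1, (key s hs).1⟩, fun s hs => (key s hs).2⟩
  · obtain ⟨s, hs⟩ := hne
    exact (htime s hs).ne (DipoleRing.Params.ReachesSingularity.causal_momenta hp hI hc ⟨s, hs⟩
      hg (fun r hr => (htime r hr).le) hr hs).1
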